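/- Let $p$ be an odd prime number and let $K$ be a totally real number field. For a prime $\mathfrak p$ of $K$ (a nonzero prime ideal of $\mathcal O_K$) above $p$, let $e(\mathfrak p|p)$ denote its ramification index over $\mathbb Q$, and let $$V_p=\{\mathfrak p : \mathfrak p \text{ is a prime of } K \text{ above } p \text{ and } e(\mathfrak p|p) \text{ is odd}\}.$$ Suppose that the class number $h(K(\sqrt{-p}))$ is odd and that $V_p\neq\emptyset$. Then there is a prime $\mathfrak p$ of $K$ above $p$ with $V_p=\{\mathfrak p\}$. Moreover, $\mathfrak p$ ramifies in $K(\sqrt{-p})/K$, and it is the only prime of $K$ not above $2$ that ramifies in $K(\sqrt{-p})/K$. -/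

import Mathlib

open NumberField

/-- The set `V_p` of the prime ideals of `𝓞 K` lying above the rational prime `p` whose
ramification index `e(𝔭|p)` over `ℤ` is odd. -/
def oddRamifiedPrimesOver (K : Type*) [Field K] (p : ℕ) : Set (Ideal (𝓞 K)) :=
  {𝔭 | 𝔭 ∈ (Ideal.span {(p : ℤ)}).primesOver (𝓞 K) ∧ Odd (𝔭.ramificationIdx ℤ)}

/-- A prime `𝔮` of `K` ramifies in `L` if some prime `𝔔` of `L` above `𝔮` has ramification index
`e(𝔔|𝔮) > 1`. -/
def RamifiesIn {K : Type*} [Field K] (L : Type*) [Field L] [Algebra K L]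
    (𝔮 : Ideal (𝓞 K)) : Prop :=
  ∃ 𝔔 ∈ 𝔮.primesOver (𝓞 L), 1 < 𝔔.ramificationIdx (𝓞 K)

/-- The set of the odd primes of `K` (the nonzero prime ideals of `𝓞 K` not above `2`)
that ramify in `L`. -/
def oddPrimesRamifyingIn (K L : Type*) [Field K] [Field L] [Algebra K L] : Set (Ideal (𝓞 K)) :=
  {𝔮 | 𝔮.IsPrime ∧ 𝔮 ≠ ⊥ ∧ (2 : 𝓞 K) ∉ 𝔮 ∧ RamifiesIn L 𝔮}

/-! The field `L` is a CM quadratic extension of `K`. As `-p` is a square in `L`, every prime of `L`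
has even ramification index over `p`; over a member `𝔭` of `V_p` the index is therefore even, so a
single, conjugation-stable prime `𝔓` lies above `𝔭`. With `h` the class number, `𝔓 ^ h = (β)`, and
the conjugate of `β` is `u * β` with `u` a root of unity. If `u = ζ ^ 2`, then `ζ * β` lies in `K`
and has even valuation at `𝔓`, against `h` odd; so `u` is not a square. Two members of `V_p` would
give non-squares `u₁`, `u₂`, whose product is a square as the torsion is cyclic, yet `β₁ * β₂` still
has odd valuation at `𝔓₁` (`eq_of_odd_classNumber`). Conversely, `K(√-p)` is unramified at the odd
primes where `-p` has even valuation, so `V_p` is exactly the set of odd ramified primes. -/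

/-! ### Odd primes of even valuation are unramified. -/

section DedekindDomain

variable {R : Type*} [CommRing R] [IsDedekindDomain R]

/-- If `c` has even valuation at `𝔮`, then up to squares `c` is a unit at `𝔮`. -/
theorem exists_sq_mul_eq_sq_mul_of_even_emultiplicity {𝔮 : Ideal R} (h𝔮 : 𝔮.IsPrime)
    (h𝔮0 : 𝔮 ≠ ⊥) {c : R} {k : ℕ} (hc : emultiplicity 𝔮 (Ideal.span {c}) = (2 * k : ℕ)) :
    ∃ a π w : R, a ∉ 𝔮 ∧ π ≠ 0 ∧ w ∉ 𝔮 ∧ a ^ 2 * c = π ^ 2 * w := by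
  have hpr : Prime 𝔮 := Ideal.prime_of_isPrime h𝔮0 h𝔮
  have hne : 𝔮 ≠ ⊤ := h𝔮.ne_top
  -- `π` has valuation exactly `k`; an element `a` of its cofactor, outside `𝔮`, clears the
  -- denominators of `c / π ^ 2` away from `𝔮`.
  obtain ⟨π, hπ, hπ'⟩ := Ideal.exists_mem_pow_notMem_pow_succ 𝔮 h𝔮0 hne k
  obtain ⟨𝔞, h𝔞⟩ := Ideal.dvd_span_singleton.mpr hπ
  have h𝔞𝔮 : ¬ 𝔞 ≤ 𝔮 := by
    intro h
    apply hπ'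
    rw [← Ideal.dvd_span_singleton, h𝔞, pow_succ]
    exact mul_dvd_mul_left _ (Ideal.dvd_iff_le.mpr h)
  obtain ⟨a, ha, ha'⟩ := SetLike.not_le_iff_exists.mp h𝔞𝔮
  have hcdvd : 𝔮 ^ (2 * k) ∣ Ideal.span {c} := pow_dvd_of_le_emultiplicity hc.ge
  have hdvd : Ideal.span {π ^ 2} ∣ Ideal.span {a ^ 2 * c} := by
    rw [← Ideal.span_singleton_pow, h𝔞, ← Ideal.span_singleton_mul_span_singleton,
      ← Ideal.span_singleton_pow, mul_pow, ← pow_mul, mul_comm, mul_comm k]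
    exact mul_dvd_mul (pow_dvd_pow_of_dvd (Ideal.dvd_span_singleton.mpr ha) 2) hcdvd
  rw [Ideal.dvd_iff_le, Ideal.span_singleton_le_span_singleton] at hdvd
  obtain ⟨w, hw⟩ := hdvd
  refine ⟨a, π, w, ha', ?_, ?_, hw⟩
  · rintro rfl
    exact hπ' (zero_mem _)
  · intro hw𝔮
    have h1 : 𝔮 ^ (2 * k + 1) ∣ Ideal.span {a ^ 2 * c} := by
      rw [hw, ← Ideal.span_singleton_mul_span_singleton, ← Ideal.span_singleton_pow, pow_succ,
        mul_comm 2, pow_mul]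
      exact mul_dvd_mul (pow_dvd_pow_of_dvd (Ideal.dvd_span_singleton.mpr hπ) 2)
        (Ideal.dvd_span_singleton.mpr hw𝔮)
    have h2 : emultiplicity 𝔮 (Ideal.span {a ^ 2}) = 0 := by
      rw [emultiplicity_eq_zero, Ideal.dvd_span_singleton]
      exact fun h ↦ ha' (h𝔮.mem_of_pow_mem _ h)
    have h3 := le_emultiplicity_of_pow_dvd h1
    rw [← Ideal.span_singleton_mul_span_singleton, emultiplicity_mul hpr, h2, hc, zero_add] at h3
    norm_cast at h3
    omega

end DedekindDomain

section Unramified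

variable {K L : Type*} [Field K] [NumberField K] [Field L] [NumberField L] [Algebra K L]

open Polynomial in
/-- An extension generated by a square root of a unit at an odd prime is unramified there. -/
theorem not_ramifiesIn_of_sq_eq {𝔮 : Ideal (𝓞 K)} (h2 : (2 : 𝓞 K) ∉ 𝔮) {β : 𝓞 L} {w : 𝓞 K}
    (hβ : β ^ 2 = algebraMap (𝓞 K) (𝓞 L) w) (hw : w ∉ 𝔮)
    (hgen : IntermediateField.adjoin K {(β : L)} = ⊤) : ¬ RamifiesIn L 𝔮 := by
  rintro ⟨𝔔, ⟨h𝔔, hover⟩, he⟩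
  have hadj : Algebra.adjoin K {algebraMap (𝓞 L) L β} = ⊤ := by
    rw [← IntermediateField.adjoin_simple_toSubalgebra_of_isAlgebraic
      (Algebra.IsAlgebraic.isAlgebraic (R := K) (algebraMap (𝓞 L) L β)), hgen]
    rfl
  have hdiff := aeval_derivative_mem_differentIdeal (𝓞 K) K L β hadj
  have hroot : aeval β (X ^ 2 - C w : (𝓞 K)[X]) = 0 := by simp [hβ]
  obtain ⟨g, hg⟩ := minpoly.isIntegrallyClosed_dvd
    (Algebra.IsIntegral.isIntegral (R := 𝓞 K) β) hroot
  -- The minimal polynomial divides `X ^ 2 - C w`, so its derivative at `β`, an element of the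
  -- different, divides `2 * β`.
  have h2β : (2 : 𝓞 L) * β ∈ differentIdeal (𝓞 K) (𝓞 L) := by
    have : aeval β (derivative (X ^ 2 - C w : (𝓞 K)[X])) =
        aeval β (derivative (minpoly (𝓞 K) β)) * aeval β g := by
      rw [hg, derivative_mul, map_add, map_mul, map_mul, minpoly.aeval, zero_mul, add_zero]
    have h' : aeval β (derivative (X ^ 2 - C w : (𝓞 K)[X])) = 2 * β := by
      rw [derivative_sub, derivative_C, sub_zero, derivative_X_sq]
      simp only [map_mul, map_ofNat, aeval_X]
    rw [← h', this]
    exact Ideal.mul_mem_right _ _ hdiff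
  have hmem : ∀ x : 𝓞 K, algebraMap (𝓞 K) (𝓞 L) x ∈ 𝔔 → x ∈ 𝔮 := by
    intro x hx
    rw [hover.over]
    exact hx
  have hnot : ¬ 𝔔 ∣ differentIdeal (𝓞 K) (𝓞 L) := by
    intro hdvd
    rcases h𝔔.mem_or_mem (Ideal.dvd_iff_le.mp hdvd h2β) with h | h
    · exact h2 (hmem 2 (by rwa [map_ofNat]))
    · exact hw (hmem w (hβ ▸ Ideal.pow_mem_of_mem _ h 2 two_pos))
  have := not_dvd_differentIdeal_iff.mp hnot
  rw [Ideal.ramificationIdx_eq_one] at he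
  exact lt_irrefl _ he

/-- If `d` has even valuation at an odd prime, this prime is unramified in `K(√d)`. -/
theorem not_ramifiesIn_of_even_emultiplicity {𝔮 : Ideal (𝓞 K)} (h𝔮 : 𝔮.IsPrime)
    (h𝔮0 : 𝔮 ≠ ⊥) (h2 : (2 : 𝓞 K) ∉ 𝔮) {d : 𝓞 K} {k : ℕ}
    (hd : emultiplicity 𝔮 (Ideal.span {d}) = (2 * k : ℕ)) {α : L}
    (hα : α ^ 2 = algebraMap K L d) (hgen : IntermediateField.adjoin K {α} = ⊤) :
    ¬ RamifiesIn L 𝔮 := by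
  obtain ⟨a, π, w, ha, hπ, hw, h⟩ := exists_sq_mul_eq_sq_mul_of_even_emultiplicity h𝔮 h𝔮0 hd
  have ha0 : algebraMap K L a ≠ 0 := by
    simp only [ne_eq, FaithfulSMul.algebraMap_eq_zero_iff]
    exact fun h ↦ ha (h ▸ zero_mem 𝔮)
  have hπ0 : algebraMap K L π ≠ 0 := by
    simpa only [ne_eq, FaithfulSMul.algebraMap_eq_zero_iff, RingOfIntegers.coe_eq_zero_iff] using hπ
  have hK : algebraMap K L a ^ 2 * algebraMap K L d = algebraMap K L π ^ 2 * algebraMap K L w := by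
    have := congrArg (fun x : 𝓞 K ↦ algebraMap K L x) h
    simpa using this
  have hβ : (algebraMap K L a * α / algebraMap K L π) ^ 2 = algebraMap K L w := by
    rw [div_pow, mul_pow, hα, hK]
    field_simp
  have hint : IsIntegral ℤ (algebraMap K L a * α / algebraMap K L π) := by
    refine IsIntegral.of_pow two_pos ?_
    rw [hβ]
    exact (RingOfIntegers.isIntegral_coe w).algebraMap
  refine not_ramifiesIn_of_sq_eq h2 (β := ⟨_, hint⟩) (w := w) ?_ hw ?_
  · exact RingOfIntegers.ext hβ
  · rw [eq_top_iff, ← hgen, IntermediateField.adjoin_simple_le_iff]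
    have h1 := IntermediateField.mem_adjoin_simple_self K (algebraMap K L a * α / algebraMap K L π)
    have h2 : α = algebraMap K L (π / a) * (algebraMap K L a * α / algebraMap K L π) := by
      rw [map_div₀]
      field_simp
    exact Set.mem_of_eq_of_mem h2 (mul_mem (IntermediateField.algebraMap_mem _ _) h1)

end Unramified

/-! ### `K(√-n)` is a totally complex quadratic extension. -/

section TotallyReal

variable {K L : Type*} [Field K] [NumberField K] [IsTotallyReal K] [Field L] [NumberField L]
  [Algebra K L] {n : ℕ} {α : L}

theorem isTotallyComplex_of_sq_eq_neg (hn : n ≠ 0) (hα : α ^ 2 = -(n : L)) :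
    IsTotallyComplex L where
  isComplex v := by
    rw [← InfinitePlace.not_isReal_iff_isComplex]
    intro hv
    have h := congrArg (InfinitePlace.embedding_of_isReal hv) hα
    rw [map_pow, map_neg, map_natCast] at h
    have : (0 : ℝ) < n := by positivity
    nlinarith [sq_nonneg (InfinitePlace.embedding_of_isReal hv α)]

theorem isQuadraticExtension_of_sq_eq_neg (hn : n ≠ 0) (hα : α ^ 2 = -(n : L))
    (hgen : IntermediateField.adjoin K {α} = ⊤) : Algebra.IsQuadraticExtension K L where
  finrank_eq_two' := by
    have hint : IsIntegral K α := Algebra.IsIntegral.isIntegral α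
    rw [← IntermediateField.finrank_top', ← hgen, IntermediateField.adjoin.finrank hint]
    apply le_antisymm
    · have : Polynomial.aeval α (Polynomial.X ^ 2 + Polynomial.C (n : K)) = 0 := by simp [hα]
      have h := Polynomial.natDegree_le_of_dvd (minpoly.dvd K α this)
        (Polynomial.monic_X_pow_add_C _ two_ne_zero).ne_zero
      rwa [Polynomial.natDegree_X_pow_add_C] at h
    · rw [minpoly.two_le_natDegree_iff hint]
      rintro ⟨x, rfl⟩
      have hx : x ^ 2 = -(n : K) := (algebraMap K L).injective (by simpa using hα)
      have v : InfinitePlace K := Classical.choice inferInstance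
      have h := congrArg (InfinitePlace.embedding_of_isReal (IsTotallyReal.isReal v)) hx
      rw [map_pow, map_neg, map_natCast] at h
      have : (0 : ℝ) < n := by positivity
      nlinarith [sq_nonneg (InfinitePlace.embedding_of_isReal (IsTotallyReal.isReal v) x)]

end TotallyReal

/-! ### Even ramification indices. -/

section Valuation

variable {K L : Type*} [Field K] [NumberField K] [Field L] [NumberField L] [Algebra K L]

theorem emultiplicity_span_algebraMap {𝔭 : Ideal (𝓞 K)} {𝔓 : Ideal (𝓞 L)} [𝔭.IsPrime] [𝔓.IsPrime]
    [𝔓.LiesOver 𝔭] (h0 : 𝔭 ≠ ⊥) {x : 𝓞 K} (hx : x ≠ 0) :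
    emultiplicity 𝔓 (Ideal.span {algebraMap (𝓞 K) (𝓞 L) x}) =
      𝔓.ramificationIdx (𝓞 K) * emultiplicity 𝔭 (Ideal.span {x}) := by
  have h𝔓 : 𝔓 ≠ ⊥ := Ideal.ne_bot_of_liesOver_of_ne_bot h0 𝔓
  rw [← Ideal.ramificationIdx'_eq_ramificationIdx 𝔭 𝔓 h0,
    ← Ideal.IsDedekindDomain.emultiplicity_map_eq_ramificationIdx'_mul (by simpa using hx)
      (Ideal.prime_of_isPrime h0 inferInstance).irreducible
      (Ideal.prime_of_isPrime h𝔓 inferInstance).irreducible h𝔓, Ideal.map_span,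
    Set.image_singleton]

/-- If `-p` is a square in `L`, the primes of odd ramification index over `p` have even
ramification index in `L`. -/
theorem even_ramificationIdx_of_mem {p : ℕ} (hp : p.Prime) {α : L} (hα : α ^ 2 = -(p : L))
    {𝔭 : Ideal (𝓞 K)} (h𝔭 : 𝔭 ∈ oddRamifiedPrimesOver K p) {𝔓 : Ideal (𝓞 L)} [𝔓.IsPrime]
    [𝔓.LiesOver 𝔭] : Even (𝔓.ramificationIdx (𝓞 K)) := by
  obtain ⟨⟨_, hover⟩, hodd⟩ := h𝔭
  have : 𝔓.LiesOver (Ideal.span {(p : ℤ)}) := Ideal.LiesOver.trans 𝔓 𝔭 _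
  have hpp : (Ideal.span {(p : ℤ)}) ≠ ⊥ := by simpa using hp.ne_zero
  have hmap : Ideal.map (algebraMap ℤ (𝓞 L)) (Ideal.span {(p : ℤ)}) = Ideal.span {(p : 𝓞 L)} := by
    rw [Ideal.map_span, Set.image_singleton, map_natCast]
  have hp0 : Ideal.span {(p : 𝓞 L)} ≠ ⊥ := by simpa using hp.ne_zero
  have htower := Ideal.ramificationIdx_tower (R := ℤ) 𝔭 𝔓
  obtain ⟨a, ha⟩ : ∃ a : 𝓞 L, (a : L) = α := by
    refine ⟨⟨α, IsIntegral.of_pow two_pos ?_⟩, rfl⟩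
    rw [hα]
    exact (isIntegral_natCast p).neg
  have hsq : a ^ 2 = -(p : 𝓞 L) := RingOfIntegers.ext (by simpa [ha] using hα)
  have hspan : Ideal.span {(p : 𝓞 L)} = Ideal.span {a} ^ 2 := by
    rw [Ideal.span_singleton_pow, hsq, Ideal.span_singleton_neg]
  have h𝔓 : 𝔓 ≠ ⊥ := Ideal.ne_bot_of_liesOver_of_ne_bot hpp 𝔓
  have hmul := Ideal.IsDedekindDomain.ramificationIdx_eq_multiplicity
    (Ideal.span {(p : ℤ)}) 𝔓 (hmap ▸ hp0)
  rw [hmap, hspan, FiniteMultiplicity.multiplicity_pow (Ideal.prime_of_isPrime h𝔓 inferInstance)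
    (FiniteMultiplicity.of_prime_left (Ideal.prime_of_isPrime h𝔓 inferInstance)
      fun h ↦ hp0 (by rw [hspan, h]; simp)), htower] at hmul
  have : Even (𝔭.ramificationIdx ℤ * 𝔓.ramificationIdx (𝓞 K)) := hmul ▸ even_two_mul _
  exact (Nat.even_mul.mp this).resolve_left (Nat.not_even_iff_odd.mpr hodd)

/-- Only one prime lies above a prime with even ramification index in a quadratic extension. -/
theorem eq_of_even_ramificationIdx [Algebra.IsQuadraticExtension K L] {𝔭 : Ideal (𝓞 K)}
    [𝔭.IsPrime] {𝔓 𝔔 : Ideal (𝓞 L)} [𝔓.IsPrime] [𝔓.LiesOver 𝔭] [𝔔.IsPrime] [𝔔.LiesOver 𝔭]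
    (he : Even (𝔓.ramificationIdx (𝓞 K))) : 𝔔 = 𝔓 := by
  have h := Ideal.ncard_primesOver_mul_ramificationIdxIn_mul_inertiaDegIn 𝔭 (𝓞 L) Gal(L/K)
  rw [IsGalois.card_aut_eq_finrank, Algebra.IsQuadraticExtension.finrank_eq_two,
    Ideal.ramificationIdxIn_eq_ramificationIdx 𝔭 𝔓 Gal(L/K)] at h
  obtain ⟨k, hk⟩ := he
  -- Cancelling 2 in `g * (2 * k) * f = 2`, with `g` the number of primes above `𝔭`.
  have h1 : (𝔭.primesOver (𝓞 L)).ncard * (k * 𝔭.inertiaDegIn (𝓞 L)) = 1 := by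
    rw [hk] at h
    linarith
  obtain ⟨P, hP⟩ := Set.ncard_eq_one.mp (Nat.eq_one_of_mul_eq_one_right h1)
  have h𝔓 : 𝔓 ∈ 𝔭.primesOver (𝓞 L) := ⟨inferInstance, inferInstance⟩
  have h𝔔 : 𝔔 ∈ 𝔭.primesOver (𝓞 L) := ⟨inferInstance, inferInstance⟩
  rw [hP, Set.mem_singleton_iff] at h𝔓 h𝔔
  rw [h𝔓, h𝔔]

end Valuation

/-! ### Principal powers of ideals, and squares in cyclic groups. -/

section ClassNumber

theorem exists_span_eq_pow_classNumber {L : Type*} [Field L] [NumberField L] {I : Ideal (𝓞 L)}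
    (hI : I ≠ ⊥) : ∃ β : 𝓞 L, Ideal.span {β} = I ^ classNumber L := by
  have h0 : I ∈ nonZeroDivisors (Ideal (𝓞 L)) := mem_nonZeroDivisors_of_ne_zero hI
  have h1 : ClassGroup.mk0 ⟨I ^ classNumber L, pow_mem h0 _⟩ = 1 := by
    rw [show (⟨I ^ classNumber L, pow_mem h0 _⟩ : nonZeroDivisors (Ideal (𝓞 L))) =
      ⟨I, h0⟩ ^ classNumber L from rfl, map_pow]
    exact pow_card_eq_one
  rw [ClassGroup.mk0_eq_one_iff] at h1
  obtain ⟨β, hβ⟩ := h1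
  exact ⟨β, hβ.symm⟩

end ClassNumber

section Torsion

/-- Non-squares are odd powers of a generator, and odd exponents add up to an even one. -/
theorem IsCyclic.isSquare_mul_of_not_isSquare {G : Type*} [CommGroup G] [IsCyclic G] {a b : G}
    (ha : ¬ IsSquare a) (hb : ¬ IsSquare b) : IsSquare (a * b) := by
  obtain ⟨g, hg⟩ := IsCyclic.exists_generator (α := G)
  obtain ⟨m, rfl⟩ := hg a
  obtain ⟨n, rfl⟩ := hg b
  have hm : ¬ Even m := fun h ↦ ha (h.isSquare_zpow g)
  have hn : ¬ Even n := fun h ↦ hb (h.isSquare_zpow g)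
  simp only [← zpow_add]
  exact (Int.even_add.mpr (iff_of_false hm hn)).isSquare_zpow g

end Torsion

/-! ### Complex conjugation and the uniqueness argument. -/

section CM

open NumberField.IsCMField NumberField.Units

variable {L : Type*} [Field L] [NumberField L] [IsCMField L]

/-- Conjugation preserves every infinite place, so the unit relating `β` to its conjugate has
absolute value 1 everywhere, hence is a root of unity. -/
theorem exists_torsion_of_span_complexConj_eq {β : 𝓞 L} (hβ0 : β ≠ 0)
    (hβ : Ideal.span {ringOfIntegersComplexConj L β} = Ideal.span {β}) :
    ∃ u : torsion L, ringOfIntegersComplexConj L β = (u : (𝓞 L)ˣ) * β := by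
  obtain ⟨u, hu⟩ := (Ideal.span_singleton_eq_span_singleton.mp hβ).symm
  have hu' : complexConj L (β : L) = β * (u : L) := by
    rw [← coe_ringOfIntegersComplexConj, ← hu]
    simp
  refine ⟨⟨u, (mem_torsion L).mpr fun w ↦ ?_⟩, by rw [← hu, mul_comm]⟩
  have h := congrArg w hu'
  rw [infinitePlace_complexConj, map_mul] at h
  have hw : w (β : L) ≠ 0 := by simpa using hβ0
  exact (mul_left_cancel₀ hw (by rw [← h, mul_one])).symm

/-- Conjugation inverts roots of unity, and `ζ⁻¹ * ζ ^ 2 = ζ`. -/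
theorem complexConj_torsion_mul_eq_self {β : 𝓞 L} (ζ : torsion L)
    (hβ : ringOfIntegersComplexConj L β = ((ζ * ζ : torsion L) : (𝓞 L)ˣ) * β) :
    ringOfIntegersComplexConj L ((ζ : (𝓞 L)ˣ) * β) = (ζ : (𝓞 L)ˣ) * β := by
  have h : ringOfIntegersComplexConj L ((ζ : (𝓞 L)ˣ) : 𝓞 L) = ((ζ⁻¹ : (𝓞 L)ˣ) : 𝓞 L) :=
    congrArg Units.val (unitsComplexConj_torsion L ζ)
  rw [map_mul, h, hβ]
  simp [← mul_assoc]

variable {K : Type*} [Field K] [IsTotallyReal K] [Algebra K L]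
  [Algebra.IsQuadraticExtension K L]

theorem complexConj_algebraMap (x : 𝓞 K) :
    ringOfIntegersComplexConj L (algebraMap (𝓞 K) (𝓞 L) x) = algebraMap (𝓞 K) (𝓞 L) x := by
  apply RingOfIntegers.ext
  rw [coe_ringOfIntegersComplexConj, complexConj_eq_self_iff]
  exact (CMExtension.equivMaximalRealSubfield K L (x : K)).2

theorem exists_algebraMap_eq_of_complexConj_eq_self {β : 𝓞 L}
    (hβ : ringOfIntegersComplexConj L β = β) : ∃ x : 𝓞 K, algebraMap (𝓞 K) (𝓞 L) x = β := by
  have h : complexConj L (β : L) = β := by rw [← coe_ringOfIntegersComplexConj, hβ]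
  rw [complexConj_eq_self_iff] at h
  obtain ⟨y, hy⟩ : ∃ y : K, algebraMap K L y = β :=
    ⟨_, CMExtension.algebraMap_equivMaximalRealSubfield_symm_apply K L ⟨β, h⟩⟩
  have hint : IsIntegral ℤ y :=
    (isIntegral_algebraMap_iff (FaithfulSMul.algebraMap_injective K L)).mp
      (hy ▸ RingOfIntegers.isIntegral_coe β)
  exact ⟨⟨y, hint⟩, RingOfIntegers.ext hy⟩

variable [NumberField K]

/-- An element of odd valuation at a ramified prime does not become real after multiplication by a
root of unity. -/
theorem not_isSquare_of_complexConj_eq {𝔭 : Ideal (𝓞 K)} {𝔓 : Ideal (𝓞 L)} [𝔭.IsPrime]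
    [𝔓.IsPrime] [𝔓.LiesOver 𝔭] (h0 : 𝔭 ≠ ⊥) (he : Even (𝔓.ramificationIdx (𝓞 K)))
    {β : 𝓞 L} (hβ0 : β ≠ 0) {n : ℕ} (hn : Odd n) (hβ : emultiplicity 𝔓 (Ideal.span {β}) = n)
    {u : torsion L} (hu : ringOfIntegersComplexConj L β = (u : (𝓞 L)ˣ) * β) : ¬ IsSquare u := by
  rintro ⟨ζ, rfl⟩
  obtain ⟨x, hx⟩ := exists_algebraMap_eq_of_complexConj_eq_self (K := K)
    (complexConj_torsion_mul_eq_self ζ hu)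
  have hx0 : x ≠ 0 := by
    rintro rfl
    simp [hβ0] at hx
  have h := emultiplicity_span_algebraMap (𝔓 := 𝔓) h0 hx0
  rw [hx, Ideal.span_singleton_mul_left_unit (Units.isUnit _), hβ,
    (FiniteMultiplicity.of_prime_left (Ideal.prime_of_isPrime h0 inferInstance)
      (by simpa using hx0)).emultiplicity_eq_multiplicity] at h
  norm_cast at h
  exact Nat.not_even_iff_odd.mpr hn (h ▸ he.mul_right _)

/-- Conjugation fixes `K`, hence permutes the primes above `𝔭`, of which there is only one. -/
theorem map_complexConj_eq {𝔭 : Ideal (𝓞 K)} {𝔓 : Ideal (𝓞 L)} [𝔭.IsPrime] [𝔓.IsPrime]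
    [𝔓.LiesOver 𝔭] (he : Even (𝔓.ramificationIdx (𝓞 K))) :
    𝔓.map (ringOfIntegersComplexConj L) = 𝔓 := by
  have hp : (𝔓.map (ringOfIntegersComplexConj L)).IsPrime := Ideal.map_isPrime_of_equiv _
  have ho : (𝔓.map (ringOfIntegersComplexConj L)).LiesOver 𝔭 := by
    constructor
    ext x
    rw [Ideal.mem_comap, Ideal.mem_map_of_equiv, Ideal.over_def 𝔓 𝔭, Ideal.mem_comap]
    constructor
    · exact fun h ↦ ⟨_, h, complexConj_algebraMap x⟩
    · rintro ⟨y, hy, hyx⟩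
      rw [← complexConj_algebraMap] at hyx
      rwa [← (ringOfIntegersComplexConj L).injective hyx]
  exact eq_of_even_ramificationIdx (𝔭 := 𝔭) he

/-- If a CM field has odd class number, at most one prime of its totally real subfield has even
ramification index. -/
theorem eq_of_odd_classNumber (hcl : Odd (classNumber L)) {𝔭₁ 𝔭₂ : Ideal (𝓞 K)}
    {𝔓₁ 𝔓₂ : Ideal (𝓞 L)} [𝔭₁.IsPrime] [𝔭₂.IsPrime] [𝔓₁.IsPrime] [𝔓₂.IsPrime] [𝔓₁.LiesOver 𝔭₁]
    [𝔓₂.LiesOver 𝔭₂] (h₁ : 𝔭₁ ≠ ⊥) (h₂ : 𝔭₂ ≠ ⊥) (he₁ : Even (𝔓₁.ramificationIdx (𝓞 K)))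
    (he₂ : Even (𝔓₂.ramificationIdx (𝓞 K))) : 𝔭₁ = 𝔭₂ := by
  by_contra hne
  have hb₁ : 𝔓₁ ≠ ⊥ := Ideal.ne_bot_of_liesOver_of_ne_bot h₁ 𝔓₁
  have hb₂ : 𝔓₂ ≠ ⊥ := Ideal.ne_bot_of_liesOver_of_ne_bot h₂ 𝔓₂
  have hp₁ : Prime 𝔓₁ := Ideal.prime_of_isPrime hb₁ inferInstance
  have hp₂ : Prime 𝔓₂ := Ideal.prime_of_isPrime hb₂ inferInstance
  have hdvd : ¬ 𝔓₁ ∣ 𝔓₂ := by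
    intro h
    have : 𝔓₁ = 𝔓₂ := associated_iff_eq.mp (hp₁.associated_of_dvd hp₂ h)
    apply hne
    rw [Ideal.over_def 𝔓₁ 𝔭₁, Ideal.over_def 𝔓₂ 𝔭₂, this]
  have key : ∀ {𝔭 : Ideal (𝓞 K)} {𝔓 : Ideal (𝓞 L)} [𝔭.IsPrime] [𝔓.IsPrime] [𝔓.LiesOver 𝔭],
      𝔓 ≠ ⊥ → Even (𝔓.ramificationIdx (𝓞 K)) → ∃ (β : 𝓞 L) (u : torsion L),
        β ≠ 0 ∧ Ideal.span {β} = 𝔓 ^ classNumber L ∧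
        ringOfIntegersComplexConj L β = (u : (𝓞 L)ˣ) * β := by
    intro 𝔭 𝔓 _ _ _ hb he
    obtain ⟨β, hβ⟩ := exists_span_eq_pow_classNumber hb
    have hβ0 : β ≠ 0 := by
      rintro rfl
      exact pow_ne_zero (classNumber L) hb (by rw [← hβ]; simp)
    obtain ⟨u, hu⟩ := exists_torsion_of_span_complexConj_eq hβ0 (by
      rw [← Set.image_singleton, ← Ideal.map_span, hβ, Ideal.map_pow,
        map_complexConj_eq (𝔭 := 𝔭) he])
    exact ⟨β, u, hβ0, hβ, hu⟩
  obtain ⟨β₁, u₁, hβ₁, hs₁, hu₁⟩ := key (𝔭 := 𝔭₁) hb₁ he₁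
  obtain ⟨β₂, u₂, hβ₂, hs₂, hu₂⟩ := key (𝔭 := 𝔭₂) hb₂ he₂
  have hm₁ : emultiplicity 𝔓₁ (Ideal.span {β₁}) = classNumber L := by
    rw [hs₁, emultiplicity_pow_self_of_prime hp₁]
  have hm₂ : emultiplicity 𝔓₂ (Ideal.span {β₂}) = classNumber L := by
    rw [hs₂, emultiplicity_pow_self_of_prime hp₂]
  have hn₁ := not_isSquare_of_complexConj_eq h₁ he₁ hβ₁ hcl hm₁ hu₁
  have hn₂ := not_isSquare_of_complexConj_eq h₂ he₂ hβ₂ hcl hm₂ hu₂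
  -- `β₂` generates a power of `𝔓₂ ≠ 𝔓₁`, so it does not change the valuation at `𝔓₁`.
  have hm : emultiplicity 𝔓₁ (Ideal.span {β₁ * β₂}) = classNumber L := by
    rw [← Ideal.span_singleton_mul_span_singleton, emultiplicity_mul hp₁, hm₁, hs₂,
      emultiplicity_eq_zero.mpr fun h ↦ hdvd (hp₁.dvd_of_dvd_pow h), add_zero]
  refine not_isSquare_of_complexConj_eq h₁ he₁ (mul_ne_zero hβ₁ hβ₂) hcl hm (u := u₁ * u₂) ?_
    (IsCyclic.isSquare_mul_of_not_isSquare hn₁ hn₂)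
  rw [map_mul, hu₁, hu₂]
  simp only [Subgroup.coe_mul, Units.val_mul]
  ring

end CM

/-! ### Comparison of `V_p` with the odd ramified primes. -/

section Main

variable {K L : Type*} [Field K] [NumberField K] [Field L] [NumberField L] [Algebra K L]

theorem ne_bot_of_mem_oddRamifiedPrimesOver {p : ℕ} (hp : p.Prime) {𝔭 : Ideal (𝓞 K)}
    (h𝔭 : 𝔭 ∈ oddRamifiedPrimesOver K p) : 𝔭 ≠ ⊥ := by
  have := h𝔭.1.2
  exact Ideal.ne_bot_of_liesOver_of_ne_bot (p := Ideal.span {(p : ℤ)})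
    (by simpa using hp.ne_zero) 𝔭

theorem oddRamifiedPrimesOver_subset {p : ℕ} (hp : p.Prime) (hp2 : p ≠ 2) {α : L}
    (hα : α ^ 2 = -(p : L)) : oddRamifiedPrimesOver K p ⊆ oddPrimesRamifyingIn K L := by
  intro 𝔭 h𝔭
  have hprime : 𝔭.IsPrime := h𝔭.1.1
  have hover := h𝔭.1.2
  refine ⟨hprime, ne_bot_of_mem_oddRamifiedPrimesOver hp h𝔭, fun h2 ↦ ?_, ?_⟩
  · have hp𝔭 : (p : 𝓞 K) ∈ 𝔭 := by
      have : (p : ℤ) ∈ Ideal.span {(p : ℤ)} := Ideal.mem_span_singleton_self _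
      rw [hover.over] at this
      simpa using this
    obtain ⟨k, hk⟩ := hp.odd_of_ne_two hp2
    apply hprime.ne_top
    rw [Ideal.eq_top_iff_one]
    have : (1 : 𝓞 K) = p - 2 * k := by rw [hk]; push_cast; ring
    rw [this]
    exact sub_mem hp𝔭 (Ideal.mul_mem_right _ _ h2)
  · obtain ⟨𝔓, h𝔓, h𝔓'⟩ := (inferInstance : Nonempty (𝔭.primesOver (𝓞 L)))
    refine ⟨𝔓, ⟨h𝔓, h𝔓'⟩, ?_⟩
    obtain ⟨k, hk⟩ := even_ramificationIdx_of_mem hp hα h𝔭 (𝔓 := 𝔓)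
    have := 𝔓.ramificationIdx_pos (𝓞 K)
    omega

theorem oddPrimesRamifyingIn_subset {p : ℕ} (hp : p.Prime) {α : L}
    (hα : α ^ 2 = -(p : L)) (hgen : IntermediateField.adjoin K {α} = ⊤) :
    oddPrimesRamifyingIn K L ⊆ oddRamifiedPrimesOver K p := by
  rintro 𝔮 ⟨h𝔮, h𝔮0, h2, hram⟩
  have hp0 : Ideal.span {(p : 𝓞 K)} ≠ ⊥ := by simpa using hp.ne_zero
  have hfin := (FiniteMultiplicity.of_prime_left (Ideal.prime_of_isPrime h𝔮0 h𝔮)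
    hp0).emultiplicity_eq_multiplicity
  have hodd : Odd (multiplicity 𝔮 (Ideal.span {(p : 𝓞 K)})) := by
    rw [← Nat.not_even_iff_odd, even_iff_exists_two_mul]
    rintro ⟨k, hk⟩
    refine not_ramifiesIn_of_even_emultiplicity h𝔮 h𝔮0 h2 (d := -(p : 𝓞 K)) (k := k) ?_
      (by simpa using hα) hgen hram
    rw [Ideal.span_singleton_neg, hfin, hk]
  -- Odd valuation is nonzero, which already places `𝔮` above `p`.
  have hp𝔮 : (p : 𝓞 K) ∈ 𝔮 := by
    rw [← Ideal.dvd_span_singleton]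
    exact dvd_of_multiplicity_pos hodd.pos
  have hmax : (Ideal.span {(p : ℤ)}).IsMaximal :=
    PrincipalIdealRing.isMaximal_of_irreducible (Nat.prime_iff_prime_int.mp hp).irreducible
  have hover : 𝔮.LiesOver (Ideal.span {(p : ℤ)}) := by
    constructor
    refine hmax.eq_of_le (Ideal.IsPrime.under ℤ 𝔮).ne_top ?_
    rw [Ideal.span_singleton_le_iff_mem, Ideal.mem_comap, map_natCast]
    exact hp𝔮
  have hmap : Ideal.map (algebraMap ℤ (𝓞 K)) (Ideal.span {(p : ℤ)}) = Ideal.span {(p : 𝓞 K)} := by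
    rw [Ideal.map_span, Set.image_singleton, map_natCast]
  refine ⟨⟨h𝔮, hover⟩, ?_⟩
  rwa [Ideal.IsDedekindDomain.ramificationIdx_eq_multiplicity (Ideal.span {(p : ℤ)}) 𝔮
    (hmap ▸ hp0), hmap]

end Main

/-- Here `L = K(√-p)`: it is generated over `K` by an element `α` with `α ^ 2 = -p`. -/
theorem mainTheorem7 (p : ℕ) (hp : p.Prime) (hp2 : p ≠ 2)
    (K : Type*) [Field K] [NumberField K] [IsTotallyReal K]
    (L : Type*) [Field L] [NumberField L] [Algebra K L]
    (α : L) (hα : α ^ 2 = -(p : L)) (hL : IntermediateField.adjoin K {α} = ⊤)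
    (hclass : Odd (classNumber L))
    (hV : (oddRamifiedPrimesOver K p).Nonempty) :
    ∃ 𝔭 : Ideal (𝓞 K),
      oddRamifiedPrimesOver K p = {𝔭} ∧ oddPrimesRamifyingIn K L = {𝔭} := by
  have : IsTotallyComplex L := isTotallyComplex_of_sq_eq_neg hp.ne_zero hα
  have : Algebra.IsQuadraticExtension K L :=
    isQuadraticExtension_of_sq_eq_neg hp.ne_zero hα hL
  have : IsCMField L := IsCMField.ofCMExtension K L
  obtain ⟨𝔭, h𝔭⟩ := hV
  have huniq : oddRamifiedPrimesOver K p = {𝔭} := by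
    refine Set.eq_singleton_iff_unique_mem.mpr ⟨h𝔭, fun 𝔮 h𝔮 ↦ ?_⟩
    have := h𝔭.1.1
    have := h𝔮.1.1
    obtain ⟨𝔓, _, _⟩ := (inferInstance : Nonempty (𝔭.primesOver (𝓞 L)))
    obtain ⟨𝔔, _, _⟩ := (inferInstance : Nonempty (𝔮.primesOver (𝓞 L)))
    exact eq_of_odd_classNumber (𝔓₁ := 𝔔) (𝔓₂ := 𝔓) hclass
      (ne_bot_of_mem_oddRamifiedPrimesOver hp h𝔮) (ne_bot_of_mem_oddRamifiedPrimesOver hp h𝔭)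
      (even_ramificationIdx_of_mem hp hα h𝔮) (even_ramificationIdx_of_mem hp hα h𝔭)
  exact ⟨𝔭, huniq, huniq ▸ (oddPrimesRamifyingIn_subset hp hα hL).antisymm
    (oddRamifiedPrimesOver_subset hp hp2 hα)⟩
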